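/- **Setting.** Let $\mathcal S,\mathcal X,\mathcal Y$ be finite non-empty alphabets, $P_S$ a probability mass function on $\mathcal S$, $P_{Y|X,S}$ a channel, $\Lambda:\{0,1\}\to\mathbb R$ a cost function, and $\Gamma\in\mathbb R$ a cost bound with $\Lambda(a)\le\Gamma$ for at least one $a\in\{0,1\}$ (for example $\Lambda(0)=0$ and $\Gamma\ge 0$). Put $h(s,1)=s$ and $h(s,0)=\ast$, where $\ast\notin\mathcal S$. All logarithms are to base 2. A code of block length $n\ge 1$ with message set $\mathcal M=\{1,\dots,|\mathcal M|\}$ consists of - a probing logic $f_A:\mathcal M\to\{0,1\}^n$ such that every action sequence $a^n=f_A(m)$ satisfies $\frac1n\sum_{i=1}^n\Lambda(a_i)\le\Gamma$; - an encoder $f_e:\mathcal M\times(\mathcal S\cup\{\ast\})^n\to\mathcal X^n$ (non-causal use of the observed states); - a decoder $f_d:\mathcal Y^n\times\mathcal S^n\to\mathcal M$. The message $M$ is uniform on $\mathcal M$, and the states $S^n$ are i.i.d. $\sim P_S$, independent of $M$. With $A^n=f_A(M)$, $S_{e,i}=h(S_i,A_i)$ and $X^n=f_e(M,S_e^n)$,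 the output is generated by $\prod_{i=1}^n P_{Y|X,S}(y_i|x_i,s_i)$. The error probability is $P_e^{(n)}=\Pr\{M\ne f_d(Y^n,S^n)\}$. The code is *causal* if the $i$-th input is a function of $(M,S_e^i)$ for every $i$. A rate $R$ is *achievable* if there is a sequence of codes of block lengths $n=1,2,\dots$ with $\frac1n\log|\mathcal M_n|\ge R$ for all $n$ and $P_e^{(n)}\to0$. It is *achievable causally* if the codes can moreover be chosen causal. The probing capacity $C(\Gamma)$ is the supremum of the achievable rates, and the causal probing capacity $C_c(\Gamma)$ is the supremum of the causally achievable rates. **Theorem 1.** Both capacities are finite and $$C(\Gamma)=C_c(\Gamma)=\max I(X;Y|S),$$ where the maximum, which is attained, is over all joint distributions of the form $$P_{A,S,S_e,X,Y}=P_A\,P_S\,\mathbf 1_{\{S_e=h(S,A)\}}\,P_{X|S_e,A}\,P_{Y|X,S}$$ for some $P_A$ on $\{0,1\}$ and some $P_{X|S_e,A}$ such that $\mathbb E[\Lambda(A)]\le\Gamma$. -/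

import Mathlib

namespace Probing

/-- The probing function `h(s, a)`: the action `a = true` (that is, `A = 1`) reveals the state,
the action `a = false` (that is, `A = 0`) yields the erasure symbol `∗`, modelled by `none`. -/
def probe {S : Type*} (s : S) (a : Bool) : Option S :=
  if a then some s else none

/-- A block code with message set `Fin M` and block length `n`. -/
structure Code (S X Y : Type*) (M n : ℕ) where
  /-- Probing logic: the action sequence as a function of the message. -/
  act : Fin M → Fin n → Bool
  /-- Encoder: the input sequence as a function of the message and of the whole observed
  partial state sequence. -/
  enc : Fin M → (Fin n → Option S) → Fin n → X
  /-- Decoder: it sees the output sequence and the complete state sequence. -/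
  dec : (Fin n → Y) → (Fin n → S) → Fin M

namespace Code

variable {S X Y : Type*} {M n : ℕ}

/-- The partial state sequence that the encoder observes for message `m` when the state sequence
is `s`. -/
def observed (c : Code S X Y M n) (m : Fin M) (s : Fin n → S) : Fin n → Option S :=
  fun i => probe (s i) (c.act m i)

/-- The channel input sequence for message `m` when the state sequence is `s`. -/
def input (c : Code S X Y M n) (m : Fin M) (s : Fin n → S) : Fin n → X :=
  c.enc m (c.observed m s)

/-- The joint probability mass function of message, state sequence and output sequence. The
actions, the observed states, the inputs and the decoded message are functions of these. -/
noncomputable def law (PS : S → ℝ) (W : X → S → Y → ℝ) (c : Code S X Y M n)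
    (m : Fin M) (s : Fin n → S) (y : Fin n → Y) : ℝ :=
  (1 / (M : ℝ)) * ∏ i, PS (s i) * W (c.input m s i) (s i) (y i)

/-- The probability that the decoded message differs from the message sent. -/
noncomputable def errorProb [Fintype S] [Fintype Y] (PS : S → ℝ) (W : X → S → Y → ℝ)
    (c : Code S X Y M n) : ℝ :=
  ∑ m, ∑ s, ∑ y, if c.dec y s = m then 0 else c.law PS W m s y

/-- Every action sequence of the code has average cost at most `Γ`. -/
def MeetsCost (Λ : Bool → ℝ) (Γ : ℝ) (c : Code S X Y M n) : Prop :=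
  ∀ m, (1 / (n : ℝ)) * ∑ i, Λ (c.act m i) ≤ Γ

/-- The encoder uses the observed partial states causally: the `i`-th input depends only on the
message and on the observed partial states up to time `i`. -/
def IsCausal (c : Code S X Y M n) : Prop :=
  ∀ (m : Fin M) (i : Fin n) (t t' : Fin n → Option S),
    (∀ j ≤ i, t j = t' j) → c.enc m t i = c.enc m t' i

end Code

/-- The rate `R` (in bits per channel use) is achievable with non-causal use of the observed
partial states: there are codes of all block lengths `n ≥ 1`, with message sets of size `M n`
and rate at least `R`, that meet the cost constraint and have vanishing error probability. -/
def AchievableNoncausal {S X Y : Type*} [Fintype S] [Fintype Y]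
    (PS : S → ℝ) (W : X → S → Y → ℝ) (Λ : Bool → ℝ) (Γ R : ℝ) : Prop :=
  ∃ (M : ℕ → ℕ) (c : ∀ n, Code S X Y (M n) n),
    (∀ n, 1 ≤ n → 0 < M n ∧ R ≤ Real.logb 2 (M n) / n ∧ (c n).MeetsCost Λ Γ) ∧
    Filter.Tendsto (fun n => (c n).errorProb PS W) Filter.atTop (nhds 0)

/-- The rate `R` (in bits per channel use) is achievable with causal use of the observed
partial states. -/
def AchievableCausal {S X Y : Type*} [Fintype S] [Fintype Y]
    (PS : S → ℝ) (W : X → S → Y → ℝ) (Λ : Bool → ℝ) (Γ R : ℝ) : Prop :=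
  ∃ (M : ℕ → ℕ) (c : ∀ n, Code S X Y (M n) n),
    (∀ n, 1 ≤ n → 0 < M n ∧ R ≤ Real.logb 2 (M n) / n ∧ (c n).MeetsCost Λ Γ ∧
      (c n).IsCausal) ∧
    Filter.Tendsto (fun n => (c n).errorProb PS W) Filter.atTop (nhds 0)

/-- The conditional mutual information `I(X;Y|S)` in bits of random variables with joint
probability mass function `p x y s`. Summands with `p x y s = 0` vanish. -/
noncomputable def condMutualInfo {X Y S : Type*} [Fintype X] [Fintype Y] [Fintype S]
    (p : X → Y → S → ℝ) : ℝ :=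
  ∑ x, ∑ y, ∑ s, p x y s *
    Real.logb 2 ((p x y s * ∑ x', ∑ y', p x' y' s) / ((∑ y', p x y' s) * ∑ x', p x' y s))

open Classical in
/-- The joint probability mass function
`P_A(a) P_S(s) 1{se = h(s,a)} P_{X|S_e,A}(x|se,a) P_{Y|X,S}(y|x,s)`. -/
noncomputable def jointLaw {S X Y : Type*} (PA : Bool → ℝ) (PS : S → ℝ)
    (Q : Option S → Bool → X → ℝ) (W : X → S → Y → ℝ)
    (a : Bool) (s : S) (se : Option S) (x : X) (y : Y) : ℝ :=
  PA a * PS s * (if se = probe s a then 1 else 0) * Q se a x * W x s y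

/-- The values of `I(X;Y|S)` over all choices of probability mass functions `P_A` and
`P_{X|S_e,A}` with expected cost at most `Γ`. -/
def informationValues {S X Y : Type*} [Fintype S] [Fintype X] [Fintype Y]
    (PS : S → ℝ) (W : X → S → Y → ℝ) (Λ : Bool → ℝ) (Γ : ℝ) : Set ℝ :=
  {I | ∃ (PA : Bool → ℝ) (Q : Option S → Bool → X → ℝ),
    PA ∈ stdSimplex ℝ Bool ∧ (∀ se a, Q se a ∈ stdSimplex ℝ X) ∧
    ∑ a, PA a * Λ a ≤ Γ ∧
    I = condMutualInfo (fun x y s => ∑ a, ∑ se, jointLaw PA PS Q W a s se x y)}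

end Probing

/-!
The capacity of the channel with probing equals the maximum of `I(X;Y|S)`, with and without
causality. Write `V x s = P(X = x | S = s)`. The information `I(X;Y|S)` depends on
`(P_A, P_{X|S_e,A})` only through `V` (`info`, `condMutualInfo_jointLaw`), and continuously so; the
feasible pairs form a compact set, hence the maximum is attained.

*Converse.* For a given code, average the laws of the action and of the input at time `i` over the
message and over `i`. The result is again a feasible pair: the encoder sees the state `s i` only
through `probe (s i) (act m i)`, while the other observed symbols are independent of `s i`
(`sum_resample`, `Code.sum_input_state`); this is where non-causal knowledge turns out to be
useless. Compare the law of the code with the reference law under which the output,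
independent of the message, has the memoryless law `∏ i, P(y_i|s_i)` that this averaged pair
induces. By Gibbs' inequality the relative entropy
dominates `(1 - P_e) log M - 1` (`Code.logb_card_le`), and because the reference is memoryless and
induced by the averaged pair, it is exactly `n I(X;Y|S)` (`exists_feasible_logb_card_le`). Neither
a chain rule nor concavity of the information is needed.

*Achievability.* Take as input letters the Shannon strategies `u = (a, f)`, an action with a map
from observed symbols to inputs. They form the input alphabet of a memoryless channel with output
`(s, y)`, whose mutual information is `I(X;Y|S)` when `a` follows `P_A` and the values `f se` are
independent with laws `P_{X|S_e,A}` (`mutualInfo_strategyChannel`). A code for that channel is a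
causal code for the probing problem. Codes exist by Feinstein's maximal construction
(`exists_threshold_code`), which allows the codewords to be confined to the set where the cost
constraint holds; the two error terms vanish by Chernoff's bound (`tendsto_prob_sum_nonpos`). For
the cost term the constraint must hold strictly in the mean, or surely, and
`exists_feasible_slack` reduces to these cases.
-/

namespace Probing

open Filter Topology

/-! ### Sums over product spaces -/

theorem sum_pi_prod {ι α : Type*} [Fintype ι] [DecidableEq ι] [Fintype α] (w : ι → α → ℝ) :
    ∑ y : ι → α, ∏ j, w j (y j) = ∏ j, ∑ b, w j b := by
  rw [Finset.prod_univ_sum, Fintype.piFinset_univ]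

/-- Under a product law, the expectation of a function of one coordinate is computed from the
corresponding marginal. -/
theorem sum_pi_prod_mul {ι α : Type*} [Fintype ι] [DecidableEq ι] [Fintype α] (w : ι → α → ℝ)
    (hw : ∀ j, ∑ b, w j b = 1) (i : ι) (g : α → ℝ) :
    ∑ y : ι → α, (∏ j, w j (y j)) * g (y i) = ∑ b, w i b * g b := by
  have h := sum_pi_prod (fun j b => w j b * if j = i then g b else 1)
  simp only [Finset.prod_mul_distrib, Finset.prod_ite_eq', Finset.mem_univ, if_true] at h
  rw [h, Finset.prod_eq_single i]
  · simp
  · intro j _ hj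
    simp [hj, hw]
  · simp

/-- Resampling one coordinate of an i.i.d. sequence does not change its law. -/
theorem sum_resample {ι α : Type*} [Fintype ι] [DecidableEq ι] [Fintype α] (p : α → ℝ)
    (hp : ∑ a, p a = 1) (i : ι) (φ : (ι → α) → ℝ) :
    ∑ x : ι → α, (∏ j, p (x j)) * ∑ a, p a * φ (Function.update x i a)
      = ∑ x : ι → α, (∏ j, p (x j)) * φ x := by
  have hR : ∑ x : ι → α, (∏ j, p (x j)) * φ x
      = ∑ z : (ι → α) × α, (∏ j, p (z.1 j)) * p z.2 * φ z.1 := by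
    rw [Fintype.sum_prod_type]
    refine Finset.sum_congr rfl fun x _ => ?_
    dsimp only
    rw [← Finset.sum_mul, ← Finset.mul_sum, hp, mul_one]
  have hL : ∑ x : ι → α, (∏ j, p (x j)) * ∑ a, p a * φ (Function.update x i a)
      = ∑ z : (ι → α) × α, (∏ j, p (z.1 j)) * p z.2 * φ (Function.update z.1 i z.2) := by
    rw [Fintype.sum_prod_type]
    refine Finset.sum_congr rfl fun x _ => ?_
    rw [Finset.mul_sum]
    exact Finset.sum_congr rfl fun a _ => by ring
  rw [hR, hL]
  -- Exchanging the `i`-th coordinate with the fresh sample preserves the joint law.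
  let e : (ι → α) × α → (ι → α) × α := fun z => (Function.update z.1 i z.2, z.1 i)
  have he : Function.Involutive e := fun z => by simp [e]
  refine Fintype.sum_equiv he.toPerm _ _ fun z => ?_
  have hprod : ∀ x : ι → α, ∏ j, p (x j) = p (x i) * ∏ j ∈ Finset.univ.erase i, p (x j) :=
    fun x => (Finset.mul_prod_erase _ _ (Finset.mem_univ i)).symm
  have hupd : ∏ j ∈ Finset.univ.erase i, p (Function.update z.1 i z.2 j)
      = ∏ j ∈ Finset.univ.erase i, p (z.1 j) :=
    Finset.prod_congr rfl fun j hj => by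
      rw [Function.update_of_ne (Finset.ne_of_mem_erase hj)]
  simp only [Function.Involutive.coe_toPerm, e]
  rw [hprod z.1, hprod (Function.update z.1 i z.2), hupd, Function.update_self]
  ring

/-! ### A law of large numbers -/

theorem exists_exp_moment_lt_one {α : Type*} [Fintype α] (p c : α → ℝ)
    (hp1 : ∑ a, p a = 1) (hc : 0 < ∑ a, p a * c a) :
    ∃ t > 0, ∑ a, p a * Real.exp (-t * c a) < 1 := by
  have hd : HasDerivAt (fun t : ℝ => ∑ a, p a * Real.exp (-t * c a))
      (∑ a, p a * (Real.exp (-0 * c a) * (-1 * c a))) 0 := by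
    refine HasDerivAt.fun_sum fun a _ => ?_
    exact ((((hasDerivAt_id (0 : ℝ)).neg).mul_const (c a)).exp).const_mul (p a)
  have hneg : ∑ a, p a * (Real.exp (-0 * c a) * (-1 * c a)) < 0 := by
    have : ∑ a, p a * (Real.exp (-0 * c a) * (-1 * c a)) = -∑ a, p a * c a := by
      rw [← Finset.sum_neg_distrib]
      exact Finset.sum_congr rfl fun a _ => by simp
    linarith
  have hs := (hasDerivAt_iff_tendsto_slope_zero.1 hd).mono_left
    (nhdsWithin_mono (0 : ℝ) (s := Set.Ioi 0) fun x hx => (Set.mem_Ioi.1 hx).ne')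
  obtain ⟨t, ht, ht0⟩ := ((hs.eventually (gt_mem_nhds hneg)).and self_mem_nhdsWithin).exists
  have ht0 : 0 < t := ht0
  refine ⟨t, ht0, ?_⟩
  simp only [zero_add, neg_zero, zero_mul, Real.exp_zero, mul_one, hp1, smul_eq_mul] at ht
  by_contra! hcon
  exact absurd ht (not_lt.2 (mul_nonneg (inv_nonneg.2 ht0.le) (sub_nonneg.2 hcon)))

open Classical in
/-- If `c` has positive mean under `p`, then the probability that an i.i.d. sample of size `n` has
nonpositive empirical sum tends to zero, by Chernoff's bound. -/
theorem tendsto_prob_sum_nonpos {α : Type*} [Fintype α] (p c : α → ℝ) (hp : ∀ a, 0 ≤ p a)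
    (hp1 : ∑ a, p a = 1) (hc : 0 < ∑ a, p a * c a) :
    Tendsto (fun n : ℕ => ∑ x : Fin n → α, if ∑ i, c (x i) ≤ 0 then ∏ i, p (x i) else 0)
      atTop (𝓝 0) := by
  obtain ⟨t, ht, hlt⟩ := exists_exp_moment_lt_one p c hp1 hc
  have h0 : 0 ≤ ∑ a, p a * Real.exp (-t * c a) :=
    Finset.sum_nonneg fun a _ => mul_nonneg (hp a) (Real.exp_pos _).le
  refine squeeze_zero (fun n => Finset.sum_nonneg fun x _ => ?_) (fun n => ?_)
    (tendsto_pow_atTop_nhds_zero_of_lt_one h0 hlt)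
  · split_ifs
    exacts [Finset.prod_nonneg fun i _ => hp _, le_rfl]
  · have := sum_pi_prod (fun (_ : Fin n) a => p a * Real.exp (-t * c a))
    rw [Finset.prod_const, Finset.card_univ, Fintype.card_fin] at this
    rw [← this]
    refine Finset.sum_le_sum fun x _ => ?_
    rw [Finset.prod_mul_distrib, ← Real.exp_sum, ← Finset.mul_sum]
    have hP : 0 ≤ ∏ i, p (x i) := Finset.prod_nonneg fun i _ => hp _
    split_ifs with hx
    · refine le_mul_of_one_le_right hP (Real.one_le_exp ?_)
      nlinarith
    · exact mul_nonneg hP (Real.exp_pos _).le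

/-! ### Feinstein's maximal code construction -/

open Classical in
/-- Feinstein's lemma, for codewords restricted to a set `F`. Decoding regions are the fibres of
`d`; a new codeword can be added as long as its threshold region, minus the region
`{z | d z < k}` already used, has conditional probability at least `1 - ε`. -/
theorem exists_threshold_code {U Z : Type*} [Fintype U] [Fintype Z] (P : U → ℝ)
    (hP : ∀ u, 0 ≤ P u) (hP1 : ∑ u, P u = 1) (K : U → Z → ℝ) (hK : ∀ u z, 0 ≤ K u z)
    (hK1 : ∀ u, ∑ z, K u z = 1) (q : Z → ℝ) (hq : ∀ z, q z = ∑ u, P u * K u z)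
    (F : Set U) (hF : F.Nonempty) {θ : ℝ} (hθ : 0 < θ) (N : ℕ) {ε : ℝ}
    (hε : N / θ + (∑ u, if u ∈ F then 0 else P u)
      + (∑ u, ∑ z, if K u z ≤ θ * q z then P u * K u z else 0) ≤ ε) :
    ∀ k ≤ N, ∃ (u : ℕ → U) (d : Z → ℕ),
      (∀ i < k, u i ∈ F ∧ 1 - ε ≤ ∑ z, if d z = i then K (u i) z else 0) ∧
      (∑ z, if d z < k then q z else 0) ≤ k / θ := by
  have hq0 : ∀ z, 0 ≤ q z := fun z => by
    rw [hq]; exact Finset.sum_nonneg fun u _ => mul_nonneg (hP u) (hK u z)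
  intro k
  induction k with
  | zero =>
    intro _
    exact ⟨fun _ => hF.some, fun _ => 0, fun i hi => absurd hi (Nat.not_lt_zero i), by simp⟩
  | succ k ih =>
    intro hk
    obtain ⟨u, d, hu, hd⟩ := ih (Nat.le_of_succ_le hk)
    obtain ⟨v, hvF, hv⟩ : ∃ v ∈ F,
        1 - ε ≤ ∑ z, if k ≤ d z ∧ θ * q z < K v z then K v z else 0 := by
      -- For `1 ≤ ε` any word of `F` will do; otherwise `0 ≤ 1 - ε`, so that
      -- `P F * (1 - ε) ≤ 1 - ε`.
      by_cases hε1 : 1 ≤ ε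
      · refine ⟨hF.some, hF.some_mem, le_trans (by linarith) (Finset.sum_nonneg fun z _ => ?_)⟩
        split_ifs
        exacts [hK _ _, le_rfl]
      by_contra! hcon
      -- Split `∑ z, K u z = 1` by: below the threshold, already used, available.
      have hpt : ∀ u, P u ≤ (∑ z, if K u z ≤ θ * q z then P u * K u z else 0)
          + (∑ z, if d z < k then P u * K u z else 0) + P u * (1 - ε)
          + (if u ∈ F then 0 else P u) := by
        intro u
        have h1 : 0 ≤ ∑ z, if K u z ≤ θ * q z then P u * K u z else 0 :=
          Finset.sum_nonneg fun z _ => by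
            split_ifs
            exacts [mul_nonneg (hP u) (hK u z), le_rfl]
        have h2 : 0 ≤ ∑ z, if d z < k then P u * K u z else 0 :=
          Finset.sum_nonneg fun z _ => by
            split_ifs
            exacts [mul_nonneg (hP u) (hK u z), le_rfl]
        by_cases huF : u ∈ F
        · have hlt := (hcon u huF).le
          have hsplit : P u * ∑ z, K u z
              ≤ (∑ z, if K u z ≤ θ * q z then P u * K u z else 0)
                + (∑ z, if d z < k then P u * K u z else 0)
                + P u * ∑ z, if k ≤ d z ∧ θ * q z < K u z then K u z else 0 := by
            rw [Finset.mul_sum, Finset.mul_sum, ← Finset.sum_add_distrib,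
              ← Finset.sum_add_distrib]
            refine Finset.sum_le_sum fun z _ => ?_
            have h0 := mul_nonneg (hP u) (hK u z)
            by_cases ha : K u z ≤ θ * q z
            · by_cases hb : d z < k <;> simp [ha, hb, not_lt.2 ha, h0]
            · by_cases hb : d z < k
              · simp [ha, hb, not_le.2 hb]
              · simp [ha, hb, not_le.1 ha, not_lt.1 hb]
          rw [hK1, mul_one] at hsplit
          have := mul_le_mul_of_nonneg_left hlt (hP u)
          simp only [huF, if_true]
          linarith
        · have := mul_nonneg (hP u) (sub_nonneg.2 (not_le.1 hε1).le)
          simp only [huF, if_false]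
          linarith
      have hsum := Finset.sum_le_sum fun u (_ : u ∈ Finset.univ) => hpt u
      rw [Finset.sum_add_distrib, Finset.sum_add_distrib, Finset.sum_add_distrib,
        ← Finset.sum_mul, hP1, one_mul] at hsum
      have hqd : (∑ u, ∑ z, if d z < k then P u * K u z else 0)
          = ∑ z, if d z < k then q z else 0 := by
        rw [Finset.sum_comm]
        refine Finset.sum_congr rfl fun z _ => ?_
        split_ifs
        exacts [(hq z).symm, by simp]
      have hkN : (k : ℝ) / θ < N / θ := by
        have : (k : ℝ) < N := by exact_mod_cast hk
        gcongr
      linarith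
    refine ⟨Function.update u k v,
      fun z => if d z < k then d z else if θ * q z < K v z then k else k + 1, ?_, ?_⟩
    · intro i hi
      rcases Nat.lt_succ_iff_lt_or_eq.1 hi with hik | rfl
      · rw [Function.update_of_ne hik.ne]
        refine ⟨(hu i hik).1, (hu i hik).2.trans (le_of_eq ?_)⟩
        refine Finset.sum_congr rfl fun z _ => ?_
        congr 1
        apply propext
        dsimp only
        split_ifs <;> omega
      · rw [Function.update_self]
        refine ⟨hvF, hv.trans (le_of_eq ?_)⟩
        refine Finset.sum_congr rfl fun z _ => ?_
        congr 1
        apply propext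
        dsimp only
        split_ifs with h1 h2
        · simp [h1, h1.ne]
        · simp [not_lt.1 h1, h2]
        · simp [h2]
    · have hvq : (∑ z, if θ * q z < K v z then q z else 0) ≤ 1 / θ := by
        rw [le_div_iff₀ hθ, Finset.sum_mul, ← hK1 v]
        refine Finset.sum_le_sum fun z _ => ?_
        split_ifs with h
        · linarith
        · simpa using hK v z
      have : (∑ z, if (if d z < k then d z else if θ * q z < K v z then k else k + 1) < k + 1
            then q z else 0)
          ≤ (∑ z, if d z < k then q z else 0) + ∑ z, if θ * q z < K v z then q z else 0 := by
        rw [← Finset.sum_add_distrib]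
        refine Finset.sum_le_sum fun z _ => ?_
        have := hq0 z
        by_cases h1 : d z < k
        · by_cases h2 : θ * q z < K v z <;> simp [h1, h2, this, Nat.lt_succ_of_lt h1]
        · by_cases h2 : θ * q z < K v z <;> simp [h1, h2]
      push_cast
      rw [add_div]
      linarith

/-! ### The coding theorem for a memoryless channel with an input cost -/

open Classical in
/-- For i.i.d. input and output letters, the event that the likelihood ratio is at most `2 ^ (n r)`
is the event that the information densities sum to at most `n r`. -/
theorem sum_threshold_le {U Z : Type*} [Fintype U] [Fintype Z] (P : U → ℝ) (hP : ∀ u, 0 ≤ P u)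
    (K : U → Z → ℝ) (hK : ∀ u z, 0 ≤ K u z) (q : Z → ℝ) (hq : ∀ z, q z = ∑ u, P u * K u z)
    (r : ℝ) (n : ℕ) :
    (∑ u : Fin n → U, ∑ z : Fin n → Z,
        if ∏ i, K (u i) (z i) ≤ (2 : ℝ) ^ (n * r) * ∏ i, q (z i)
        then (∏ i, P (u i)) * ∏ i, K (u i) (z i) else 0)
      ≤ ∑ x : Fin n → U × Z,
        if ∑ i, (Real.logb 2 (K (x i).1 (x i).2 / q (x i).2) - r) ≤ 0
        then ∏ i, P (x i).1 * K (x i).1 (x i).2 else 0 := by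
  rw [← Fintype.sum_prod_type' (f := fun (u : Fin n → U) (z : Fin n → Z) =>
      if ∏ i, K (u i) (z i) ≤ (2 : ℝ) ^ (n * r) * ∏ i, q (z i)
        then (∏ i, P (u i)) * ∏ i, K (u i) (z i) else 0),
    ← (Equiv.arrowProdEquivProdArrow (Fin n) (fun _ => U) (fun _ => Z)).sum_comp]
  refine Finset.sum_le_sum fun x _ => ?_
  simp only [Equiv.arrowProdEquivProdArrow, Equiv.coe_fn_mk, ← Finset.prod_mul_distrib]
  have h0 : 0 ≤ ∏ i, P (x i).1 * K (x i).1 (x i).2 :=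
    Finset.prod_nonneg fun i _ => mul_nonneg (hP _) (hK _ _)
  -- Off the support both sides vanish; on it, all logarithms below are of positive numbers.
  by_cases hzero : ∏ i, P (x i).1 * K (x i).1 (x i).2 = 0
  · rw [hzero]; simp
  have hne : ∀ i, P (x i).1 ≠ 0 ∧ K (x i).1 (x i).2 ≠ 0 := fun i =>
    mul_ne_zero_iff.1 (Finset.prod_ne_zero_iff.1 hzero i (Finset.mem_univ i))
  have hKpos : ∀ i, 0 < K (x i).1 (x i).2 := fun i => (hK _ _).lt_of_ne' (hne i).2
  have hqpos : ∀ i, 0 < q (x i).2 := fun i => by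
    rw [hq]
    exact Finset.sum_pos' (fun u _ => mul_nonneg (hP u) (hK u _))
      ⟨(x i).1, Finset.mem_univ _, mul_pos ((hP _).lt_of_ne' (hne i).1) (hKpos i)⟩
  split_ifs with h1 h2
  · exact le_rfl
  · refine absurd ?_ h2
    have hlog := Real.logb_le_logb_of_le one_lt_two (Finset.prod_pos fun i _ => hKpos i) h1
    rw [Real.logb_mul (Real.rpow_pos_of_pos two_pos _).ne'
        (Finset.prod_pos fun i _ => hqpos i).ne', Real.logb_rpow two_pos (by norm_num),
      Real.logb_prod _ _ fun i _ => (hKpos i).ne', Real.logb_prod _ _ fun i _ => (hqpos i).ne']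
      at hlog
    have : ∀ i, Real.logb 2 (K (x i).1 (x i).2 / q (x i).2) - r
        = Real.logb 2 (K (x i).1 (x i).2) - Real.logb 2 (q (x i).2) - r := fun i => by
      rw [Real.logb_div (hKpos i).ne' (hqpos i).ne']
    simp only [this, Finset.sum_sub_distrib, Finset.sum_const, Finset.card_univ,
      Fintype.card_fin, nsmul_eq_mul]
    linarith
  · exact h0
  · exact le_rfl

open Classical in
/-- The probability that an i.i.d. sequence violates the cost constraint `0 ≤ ∑ i, c (u i)` tends
to zero if the slack `c` has positive mean, or if it is nonnegative on the support. -/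
theorem tendsto_prob_sum_neg {U : Type*} [Fintype U] (P c : U → ℝ)
    (hP : ∀ u, 0 ≤ P u) (hP1 : ∑ u, P u = 1)
    (hc : 0 < ∑ u, P u * c u ∨ ∀ u, P u ≠ 0 → 0 ≤ c u) :
    Tendsto (fun n : ℕ => ∑ u : Fin n → U, if 0 ≤ ∑ i, c (u i) then 0 else ∏ i, P (u i))
      atTop (𝓝 0) := by
  have hprod : ∀ n (u : Fin n → U), 0 ≤ ∏ i, P (u i) := fun n u =>
    Finset.prod_nonneg fun i _ => hP _
  rcases hc with hc | hc
  · refine squeeze_zero (fun n => Finset.sum_nonneg fun u _ => ?_)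
      (fun n => Finset.sum_le_sum fun u _ => ?_) (tendsto_prob_sum_nonpos P c hP hP1 hc)
    · split_ifs
      exacts [le_rfl, hprod n u]
    · split_ifs with h1 h2 h2
      exacts [hprod n u, le_rfl, le_rfl, absurd (not_le.1 h1).le h2]
  · refine tendsto_const_nhds.congr fun n => (Finset.sum_eq_zero fun u _ => ?_).symm
    split_ifs with h
    · rfl
    · by_contra hne
      exact h (Finset.sum_nonneg fun i _ =>
        hc _ (Finset.prod_ne_zero_iff.1 hne i (Finset.mem_univ i)))

/-- Achievability for a memoryless channel `K` with input law `P`: below the mutual information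
there are codes with maximal error probability tending to zero, all of whose codewords satisfy
`0 ≤ ∑ i, c (u i)`. -/
theorem exists_channel_codes {U Z : Type*} [Fintype U] [Fintype Z] (P : U → ℝ)
    (hP : ∀ u, 0 ≤ P u) (hP1 : ∑ u, P u = 1) (K : U → Z → ℝ) (hK : ∀ u z, 0 ≤ K u z)
    (hK1 : ∀ u, ∑ z, K u z = 1) (c : U → ℝ)
    (hc : 0 < ∑ u, P u * c u ∨ ∀ u, P u ≠ 0 → 0 ≤ c u) (hc0 : ∃ u, 0 ≤ c u) {R : ℝ}
    (hR0 : 0 < R)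
    (hR : R < ∑ u, ∑ z, P u * K u z * Real.logb 2 (K u z / ∑ u', P u' * K u' z)) :
    ∃ (M : ℕ → ℕ) (ε : ℕ → ℝ), Tendsto ε atTop (𝓝 0) ∧ ∀ n : ℕ, (2 : ℝ) ^ (n * R) ≤ M n ∧
      ∃ (u : Fin (M n) → Fin n → U) (d : (Fin n → Z) → Fin (M n)),
        (∀ m, 0 ≤ ∑ i, c (u m i)) ∧
        ∀ m, (∑ z, if d z = m then 0 else ∏ i, K (u m i) (z i)) ≤ ε n := by
  classical
  -- For `r` strictly between the rate and the mutual information, and the threshold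
  -- `2 ^ (n * r)`, both error terms of Feinstein's lemma that do not concern the cost tend to zero.
  obtain ⟨r, hRr, hrI⟩ := exists_between hR
  set q : Z → ℝ := fun z => ∑ u, P u * K u z with hq
  let M : ℕ → ℕ := fun n => ⌈(2 : ℝ) ^ (n * R)⌉₊
  let T : ℕ → ℝ := fun n => ∑ x : Fin n → U × Z,
    if ∑ i, (Real.logb 2 (K (x i).1 (x i).2 / q (x i).2) - r) ≤ 0
    then ∏ i, P (x i).1 * K (x i).1 (x i).2 else 0
  let V : ℕ → ℝ := fun n => ∑ u : Fin n → U, if 0 ≤ ∑ i, c (u i) then 0 else ∏ i, P (u i)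
  have hMpos : ∀ n, 0 < M n := fun n => Nat.ceil_pos.2 (Real.rpow_pos_of_pos two_pos _)
  have hT : Tendsto T atTop (𝓝 0) := by
    refine tendsto_prob_sum_nonpos (fun x : U × Z => P x.1 * K x.1 x.2)
      (fun x => Real.logb 2 (K x.1 x.2 / q x.2) - r) (fun x => mul_nonneg (hP _) (hK _ _)) ?_ ?_
    · rw [Fintype.sum_prod_type]
      simp [← Finset.mul_sum, hK1, hP1]
    · rw [Fintype.sum_prod_type]
      simp only [mul_sub, Finset.sum_sub_distrib]
      have : ∑ u, ∑ z, P u * K u z * r = r := by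
        simp [← Finset.sum_mul, ← Finset.mul_sum, hK1, hP1]
      rw [this]
      exact sub_pos.2 hrI
  have hV : Tendsto V atTop (𝓝 0) := tendsto_prob_sum_neg P c hP hP1 hc
  have hMθ : Tendsto (fun n : ℕ => (M n : ℝ) / (2 : ℝ) ^ (n * r)) atTop (𝓝 0) := by
    have hlim : Tendsto (fun n : ℕ => 2 * ((2 : ℝ) ^ (R - r)) ^ n) atTop (𝓝 0) := by
      have := (tendsto_pow_atTop_nhds_zero_of_lt_one (r := (2 : ℝ) ^ (R - r))
        (Real.rpow_pos_of_pos two_pos _).le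
        (Real.rpow_lt_one_of_one_lt_of_neg one_lt_two (sub_neg.2 hRr))).const_mul 2
      simpa using this
    refine squeeze_zero (fun n => by positivity) (fun n => ?_) hlim
    have h1 : (1 : ℝ) ≤ (2 : ℝ) ^ (n * R) :=
      Real.one_le_rpow one_le_two (mul_nonneg n.cast_nonneg hR0.le)
    have h2 : (M n : ℝ) ≤ 2 * (2 : ℝ) ^ (n * R) := by
      have := (Nat.ceil_lt_add_one (zero_le_one.trans h1)).le
      change (⌈(2 : ℝ) ^ (n * R)⌉₊ : ℝ) ≤ _
      linarith
    calc (M n : ℝ) / (2 : ℝ) ^ (n * r) ≤ 2 * (2 : ℝ) ^ (n * R) / (2 : ℝ) ^ (n * r) := by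
          gcongr
      _ = 2 * ((2 : ℝ) ^ (R - r)) ^ n := by
          rw [mul_div_assoc, ← Real.rpow_sub two_pos, ← Real.rpow_natCast,
            ← Real.rpow_mul two_pos.le]
          ring_nf
  refine ⟨M, fun n => M n / (2 : ℝ) ^ (n * r) + V n + T n, ?_, fun n => ⟨Nat.le_ceil _, ?_⟩⟩
  · simpa using (hMθ.add hV).add hT
  obtain ⟨u₀, hu₀⟩ := hc0
  obtain ⟨u, d, hu, -⟩ := exists_threshold_code (fun u : Fin n → U => ∏ i, P (u i))
    (fun u => Finset.prod_nonneg fun i _ => hP _)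
    (by rw [sum_pi_prod (fun _ => P)]; simp [hP1])
    (fun u (z : Fin n → Z) => ∏ i, K (u i) (z i))
    (fun u z => Finset.prod_nonneg fun i _ => hK _ _)
    (fun u => by rw [sum_pi_prod (fun i => K (u i))]; simp [hK1])
    (fun z => ∏ i, q (z i))
    (fun z => by
      simp only [hq, ← Finset.prod_mul_distrib]
      exact (sum_pi_prod (fun i u => P u * K u (z i))).symm)
    {u | 0 ≤ ∑ i, c (u i)} ⟨fun _ => u₀, Finset.sum_nonneg fun _ _ => hu₀⟩
    (Real.rpow_pos_of_pos two_pos (n * r)) (M n)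
    (ε := M n / (2 : ℝ) ^ (n * r) + V n + T n)
    (by
      have := sum_threshold_le P hP K hK q (fun _ => rfl) r n
      simp only [Set.mem_ofPred_eq]
      gcongr)
    (M n) le_rfl
  refine ⟨fun m => u m, fun z => if h : d z < M n then ⟨d z, h⟩ else ⟨0, hMpos n⟩,
    fun m => (hu m m.2).1, fun m => ?_⟩
  have h1 := (hu m m.2).2
  have h2 : (∑ z : Fin n → Z, ∏ i, K (u m i) (z i)) = 1 := by
    rw [sum_pi_prod (fun i => K (u m i))]; simp [hK1]
  refine le_trans ?_ (sub_le_comm.1 h1)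
  rw [← h2, ← Finset.sum_sub_distrib]
  refine Finset.sum_le_sum fun z _ => ?_
  have h0 : 0 ≤ ∏ i, K (u m i) (z i) := Finset.prod_nonneg fun i _ => hK _ _
  by_cases hd : d z = m
  · simp [hd]
  · rw [if_neg hd, sub_zero]
    split_ifs
    exacts [h0, le_rfl]

/-! ### The information functional -/

/-- `I(X;Y|S)` as a functional of the conditional input law `V x s = P(X = x | S = s)`, written as
the mean of the information density `log (W(y|x,s) / P(y|s))`. -/
noncomputable def info {S X Y : Type*} [Fintype S] [Fintype X] [Fintype Y]
    (PS : S → ℝ) (W : X → S → Y → ℝ) (V : X → S → ℝ) : ℝ :=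
  ∑ s, PS s * ∑ x, V x s *
    ∑ y, W x s y * Real.logb 2 (W x s y / ∑ x', V x' s * W x' s y)

/-- The conditional law of the input `X` given the state `S` that is induced by `P_A` and
`P_{X|S_e,A}`. -/
noncomputable def inputLaw {S X : Type*} (PA : Bool → ℝ) (Q : Option S → Bool → X → ℝ)
    (x : X) (s : S) : ℝ :=
  ∑ a, PA a * Q (probe s a) a x

/-- The pairs `(P_A, P_{X|S_e,A})` of mean cost at most `Γ`. -/
def feasible (S X : Type*) [Fintype X] (Λ : Bool → ℝ) (Γ : ℝ) :
    Set ((Bool → ℝ) × (Option S → Bool → X → ℝ)) :=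
  {p | p.1 ∈ stdSimplex ℝ Bool ∧ (∀ se a, p.2 se a ∈ stdSimplex ℝ X) ∧ ∑ a, p.1 a * Λ a ≤ Γ}

theorem inputLaw_nonneg {S X : Type*} [Fintype X]
    {PA : Bool → ℝ} {Q : Option S → Bool → X → ℝ}
    (hPA : PA ∈ stdSimplex ℝ Bool) (hQ : ∀ se a, Q se a ∈ stdSimplex ℝ X) (x : X) (s : S) :
    0 ≤ inputLaw PA Q x s :=
  Finset.sum_nonneg fun a _ => mul_nonneg (hPA.1 a) ((hQ _ a).1 x)

theorem sum_inputLaw {S X : Type*} [Fintype X]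
    {PA : Bool → ℝ} {Q : Option S → Bool → X → ℝ}
    (hPA : PA ∈ stdSimplex ℝ Bool) (hQ : ∀ se a, Q se a ∈ stdSimplex ℝ X) (s : S) :
    ∑ x, inputLaw PA Q x s = 1 := by
  simp only [inputLaw]
  rw [Finset.sum_comm]
  simp only [← Finset.mul_sum, (hQ _ _).2, mul_one]
  exact hPA.2

theorem sum_jointLaw {S X Y : Type*} [Fintype S]
    (PA : Bool → ℝ) (PS : S → ℝ) (Q : Option S → Bool → X → ℝ)
    (W : X → S → Y → ℝ) (x : X) (s : S) (y : Y) :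
    ∑ a, ∑ se, jointLaw PA PS Q W a s se x y = PS s * inputLaw PA Q x s * W x s y := by
  classical
  have h : ∀ a, ∑ se, jointLaw PA PS Q W a s se x y
      = PA a * PS s * Q (probe s a) a x * W x s y := fun a => by
    rw [Finset.sum_eq_single (probe s a)]
    · simp [jointLaw]
    · intro se _ hse
      simp [jointLaw, hse]
    · simp
  simp only [h, inputLaw, Finset.mul_sum, Finset.sum_mul]
  exact Finset.sum_congr rfl fun a _ => by ring

theorem condMutualInfo_jointLaw {S X Y : Type*} [Fintype S] [Fintype X] [Fintype Y]
    (PS : S → ℝ) {W : X → S → Y → ℝ}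
    (hW : ∀ x s, W x s ∈ stdSimplex ℝ Y) {PA : Bool → ℝ} {Q : Option S → Bool → X → ℝ}
    (hPA : PA ∈ stdSimplex ℝ Bool) (hQ : ∀ se a, Q se a ∈ stdSimplex ℝ X) :
    condMutualInfo (fun x y s => ∑ a, ∑ se, jointLaw PA PS Q W a s se x y)
      = info PS W (inputLaw PA Q) := by
  simp only [sum_jointLaw, condMutualInfo]
  set V := inputLaw PA Q with hV
  have h1 : ∀ x s, ∑ y, PS s * V x s * W x s y = PS s * V x s := fun x s => by
    rw [← Finset.mul_sum, (hW x s).2, mul_one]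
  have h2 : ∀ s, ∑ x, PS s * V x s = PS s := fun s => by
    rw [← Finset.mul_sum, sum_inputLaw hPA hQ, mul_one]
  have h3 : ∀ y s, ∑ x, PS s * V x s * W x s y = PS s * ∑ x, V x s * W x s y := fun y s => by
    rw [Finset.mul_sum]
    exact Finset.sum_congr rfl fun x _ => by ring
  simp only [h1, h2, h3, info, Finset.mul_sum]
  have hswap : ∀ f : X → Y → S → ℝ, ∑ x, ∑ y, ∑ s, f x y s = ∑ s, ∑ x, ∑ y, f x y s := by
    intro f
    rw [Finset.sum_comm, Finset.sum_congr rfl fun y _ => Finset.sum_comm, Finset.sum_comm]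
    exact Finset.sum_congr rfl fun s _ => Finset.sum_comm
  rw [hswap]
  refine Finset.sum_congr rfl fun s _ => Finset.sum_congr rfl fun x _ =>
    Finset.sum_congr rfl fun y _ => ?_
  by_cases hs : PS s = 0
  · simp [hs]
  by_cases hx : V x s = 0
  · simp [hx]
  simp only [← Finset.mul_sum]
  rw [show PS s * V x s * W x s y * PS s / (PS s * V x s * (PS s * ∑ i, V i s * W i s y))
      = (PS s * V x s * PS s) * W x s y / ((PS s * V x s * PS s) * ∑ i, V i s * W i s y) by ring_nf,
    mul_div_mul_left _ _ (mul_ne_zero (mul_ne_zero hs hx) hs)]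
  ring

/-- The information functional as a difference of entropies, the form in which it is visibly
continuous. -/
theorem info_eq_sub {S X Y : Type*} [Fintype S] [Fintype X] [Fintype Y]
    (PS : S → ℝ) {W : X → S → Y → ℝ} (hW : ∀ x s, W x s ∈ stdSimplex ℝ Y)
    {V : X → S → ℝ} (hV : ∀ x s, 0 ≤ V x s) :
    info PS W V = (∑ s, PS s * ((∑ x, ∑ y, V x s * (W x s y * Real.log (W x s y)))
      - ∑ y, (∑ x, V x s * W x s y) * Real.log (∑ x, V x s * W x s y))) / Real.log 2 := by
  rw [info, Finset.sum_div]
  refine Finset.sum_congr rfl fun s _ => ?_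
  rw [mul_div_assoc]
  congr 1
  have h : ∀ x y, V x s * (W x s y * Real.logb 2 (W x s y / ∑ x', V x' s * W x' s y))
      = (V x s * (W x s y * Real.log (W x s y))
        - V x s * W x s y * Real.log (∑ x', V x' s * W x' s y)) / Real.log 2 := by
    intro x y
    by_cases hne : V x s * W x s y = 0
    · rcases mul_eq_zero.1 hne with h | h <;> simp [h]
    have hpos : 0 < ∑ x', V x' s * W x' s y :=
      Finset.sum_pos' (fun x' _ => mul_nonneg (hV x' s) ((hW x' s).1 y))
        ⟨x, Finset.mem_univ x, (mul_nonneg (hV x s) ((hW x s).1 y)).lt_of_ne' hne⟩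
    rw [Real.logb, Real.log_div (mul_ne_zero_iff.1 hne).2 hpos.ne']
    ring
  simp only [Finset.mul_sum, h]
  simp only [← Finset.sum_div, Finset.sum_sub_distrib, Finset.sum_mul]
  rw [Finset.sum_comm (f := fun x y => V x s * W x s y * Real.log (∑ x', V x' s * W x' s y))]

theorem continuousOn_info {S X Y : Type*} [Fintype S] [Fintype X] [Fintype Y]
    (PS : S → ℝ) {W : X → S → Y → ℝ}
    (hW : ∀ x s, W x s ∈ stdSimplex ℝ Y) :
    ContinuousOn (info PS W) {V | ∀ x s, 0 ≤ V x s} := by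
  have hc : Continuous fun V : X → S → ℝ =>
      (∑ s, PS s * ((∑ x, ∑ y, V x s * (W x s y * Real.log (W x s y)))
        - ∑ y, (∑ x, V x s * W x s y) * Real.log (∑ x, V x s * W x s y))) / Real.log 2 := by
    refine Continuous.div_const (continuous_finsetSum _ fun s _ => continuous_const.mul
      (Continuous.sub (by fun_prop) (continuous_finsetSum _ fun y _ => ?_))) _
    exact Real.continuous_mul_log.comp
      (f := fun V : X → S → ℝ => ∑ x, V x s * W x s y) (by fun_prop)
  exact hc.continuousOn.congr fun V hV => info_eq_sub PS hW hV

theorem continuous_inputLaw {S X : Type*} :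
    Continuous fun p : (Bool → ℝ) × (Option S → Bool → X → ℝ) => inputLaw p.1 p.2 := by
  unfold inputLaw
  fun_prop

theorem informationValues_eq_image {S X Y : Type*} [Fintype S] [Fintype X] [Fintype Y]
    (PS : S → ℝ) {W : X → S → Y → ℝ}
    (hW : ∀ x s, W x s ∈ stdSimplex ℝ Y) (Λ : Bool → ℝ) (Γ : ℝ) :
    informationValues PS W Λ Γ
      = (fun p => info PS W (inputLaw p.1 p.2)) '' feasible S X Λ Γ := by
  ext I
  constructor
  · rintro ⟨PA, Q, hPA, hQ, hc, rfl⟩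
    exact ⟨(PA, Q), ⟨hPA, hQ, hc⟩, (condMutualInfo_jointLaw PS hW hPA hQ).symm⟩
  · rintro ⟨⟨PA, Q⟩, ⟨hPA, hQ, hc⟩, rfl⟩
    exact ⟨PA, Q, hPA, hQ, hc, (condMutualInfo_jointLaw PS hW hPA hQ).symm⟩

theorem exists_isGreatest_informationValues {S X Y : Type*} [Fintype S] [Fintype X] [Fintype Y]
    [Nonempty X] (PS : S → ℝ) {W : X → S → Y → ℝ}
    (hW : ∀ x s, W x s ∈ stdSimplex ℝ Y) {Λ : Bool → ℝ} {Γ : ℝ} (hΓ : ∃ a, Λ a ≤ Γ) :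
    ∃ C, IsGreatest (informationValues PS W Λ Γ) C := by
  classical
  rw [informationValues_eq_image PS hW]
  have hcompact : IsCompact (feasible S X Λ Γ) := by
    have h1 : IsCompact (stdSimplex ℝ Bool ×ˢ
        Set.univ.pi fun _ : Option S => Set.univ.pi fun _ : Bool => stdSimplex ℝ X) :=
      (isCompact_stdSimplex ℝ Bool).prod
        (isCompact_univ_pi fun _ => isCompact_univ_pi fun _ => isCompact_stdSimplex ℝ X)
    have h2 : IsClosed {p : (Bool → ℝ) × (Option S → Bool → X → ℝ) | ∑ a, p.1 a * Λ a ≤ Γ} :=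
      isClosed_le (by fun_prop) continuous_const
    refine (h1.inter_right h2).of_isClosed_subset ?_ ?_
    · convert h1.isClosed.inter h2 using 1
      ext p
      simp [feasible, and_assoc]
    · rintro p ⟨hp1, hp2, hp3⟩
      exact ⟨⟨hp1, fun se _ a _ => hp2 se a⟩, hp3⟩
  have hne : (feasible S X Λ Γ).Nonempty := by
    obtain ⟨a, ha⟩ := hΓ
    obtain ⟨x⟩ := ‹Nonempty X›
    refine ⟨(Pi.single a 1, fun _ _ => Pi.single x 1), single_mem_stdSimplex ℝ a,
      fun _ _ => single_mem_stdSimplex ℝ x, ?_⟩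
    simpa [Pi.single_apply] using ha
  have hcont : ContinuousOn (fun p => info PS W (inputLaw p.1 p.2)) (feasible S X Λ Γ) :=
    (continuousOn_info PS hW).comp continuous_inputLaw.continuousOn
      fun p hp => inputLaw_nonneg hp.1 hp.2.1
  obtain ⟨p, hp, hmax⟩ := hcompact.exists_isMaxOn hne hcont
  exact ⟨_, ⟨p, hp, rfl⟩, by rintro _ ⟨p', hp', rfl⟩; exact hmax hp'⟩

/-! ### The converse -/

/-- Gibbs' inequality. -/
theorem sum_mul_log_div_nonneg {ι : Type*} [Fintype ι] (p r : ι → ℝ) (hp : ∀ i, 0 ≤ p i)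
    (hr : ∀ i, 0 ≤ r i) (hp1 : ∑ i, p i = 1) (hr1 : ∑ i, r i ≤ 1)
    (hpr : ∀ i, p i ≠ 0 → r i ≠ 0) : 0 ≤ ∑ i, p i * Real.logb 2 (p i / r i) := by
  have h : ∀ i, p i - r i ≤ p i * Real.log (p i / r i) := fun i => by
    rcases eq_or_ne (p i) 0 with h0 | h0
    · simpa [h0] using hr i
    have hpi := (hp i).lt_of_ne' h0
    have hri := (hr i).lt_of_ne' (hpr i h0)
    have h1 := mul_le_mul_of_nonneg_left (Real.log_le_sub_one_of_pos (div_pos hri hpi)) hpi.le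
    rw [← inv_div (r i) (p i), Real.log_inv]
    rw [mul_sub, mul_div_cancel₀ _ h0] at h1
    linarith
  have hsum := Finset.sum_le_sum fun i (_ : i ∈ Finset.univ) => h i
  rw [Finset.sum_sub_distrib, hp1] at hsum
  simp only [Real.logb, ← mul_div_assoc, ← Finset.sum_div]
  exact div_nonneg (by linarith) (Real.log_nonneg one_le_two)

namespace Code

variable {S X Y : Type*} {M n : ℕ}

theorem law_nonneg {PS : S → ℝ} (hPS : ∀ s, 0 ≤ PS s) {W : X → S → Y → ℝ}
    (hW : ∀ x s y, 0 ≤ W x s y) (c : Code S X Y M n) (m : Fin M) (s : Fin n → S)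
    (y : Fin n → Y) : 0 ≤ c.law PS W m s y :=
  mul_nonneg (by positivity) (Finset.prod_nonneg fun _ _ => mul_nonneg (hPS _) (hW _ _ _))

theorem sum_law_mul [Fintype Y] (PS : S → ℝ) {W : X → S → Y → ℝ}
    (hW : ∀ x s, ∑ y, W x s y = 1) (c : Code S X Y M n) (m : Fin M) (s : Fin n → S)
    (i : Fin n) (g : Y → ℝ) :
    ∑ y, c.law PS W m s y * g (y i)
      = (1 / (M : ℝ)) * (∏ j, PS (s j)) * ∑ b, W (c.input m s i) (s i) b * g b := by
  rw [← sum_pi_prod_mul (fun j => W (c.input m s j) (s j)) (fun j => hW _ _) i g,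
    Finset.mul_sum]
  refine Finset.sum_congr rfl fun y _ => ?_
  rw [law, Finset.prod_mul_distrib]
  ring

theorem sum_law [Fintype Y] (PS : S → ℝ) {W : X → S → Y → ℝ}
    (hW : ∀ x s, ∑ y, W x s y = 1) (c : Code S X Y M n) (m : Fin M) (s : Fin n → S) :
    ∑ y, c.law PS W m s y = (1 / (M : ℝ)) * ∏ j, PS (s j) := by
  simp only [law, Finset.prod_mul_distrib]
  rw [← Finset.mul_sum, ← Finset.mul_sum, sum_pi_prod (fun j => W (c.input m s j) (s j))]
  simp [hW]

/-- Fano-type bound against an arbitrary memoryless output law `q`. It is Gibbs' inequality for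
the law of the code against the reference law that has output `q` independent of the message and
is tilted by `(M + 1) / 2` on correct decoding and by `1 / 2` otherwise; the tilted reference law
has total mass one because a decoder without access to the channel is correct with probability
`1 / M`. -/
theorem logb_card_le [Fintype S] [Fintype Y] {PS : S → ℝ} (hPS : PS ∈ stdSimplex ℝ S)
    {W : X → S → Y → ℝ} (hW : ∀ x s, W x s ∈ stdSimplex ℝ Y) (c : Code S X Y M n) (hM : 0 < M)
    (q : S → Y → ℝ) (hq : ∀ s, q s ∈ stdSimplex ℝ Y)
    (hWq : ∀ m s y, c.law PS W m s y ≠ 0 → ∀ i, q (s i) (y i) ≠ 0) :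
    (1 - c.errorProb PS W) * Real.logb 2 M - 1
      ≤ ∑ i, ∑ m, ∑ s : Fin n → S, (1 / (M : ℝ)) * (∏ j, PS (s j)) *
          ∑ b, W (c.input m s i) (s i) b *
            Real.logb 2 (W (c.input m s i) (s i) b / q (s i) b) := by
  classical
  have hM0 : (M : ℝ) ≠ 0 := by exact_mod_cast hM.ne'
  have hM' : (0 : ℝ) < M := by exact_mod_cast hM
  have hlaw0 := c.law_nonneg hPS.1 (fun x s => (hW x s).1)
  let τ : Fin M → (Fin n → S) → (Fin n → Y) → ℝ := fun m s y =>
    ((if c.dec y s = m then (M : ℝ) else 0) + 1) / 2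
  let r : Fin M × (Fin n → S) × (Fin n → Y) → ℝ := fun z =>
    (1 / (M : ℝ)) * (∏ j, PS (z.2.1 j) * q (z.2.1 j) (z.2.2 j)) * τ z.1 z.2.1 z.2.2
  let p : Fin M × (Fin n → S) × (Fin n → Y) → ℝ := fun z => c.law PS W z.1 z.2.1 z.2.2
  have hτ : ∀ m s y, 0 < τ m s y := fun m s y => by
    simp only [τ]
    split_ifs <;> positivity
  have hPSn : ∑ s : Fin n → S, ∏ j, PS (s j) = 1 := by
    rw [sum_pi_prod (fun _ => PS)]; simp [hPS.2]
  have hp1 : ∑ z, p z = 1 := by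
    simp only [p, Fintype.sum_prod_type, sum_law PS (fun x s => (hW x s).2), ← Finset.mul_sum,
      hPSn]
    simp [hM0]
  have hr1 : ∑ z, r z = 1 := by
    have hτ1 : ∀ s y, ∑ m, (1 / (M : ℝ)) * τ m s y = 1 := fun s y => by
      rw [← Finset.mul_sum]
      simp only [τ, ← Finset.sum_div, Finset.sum_add_distrib, Finset.sum_ite_eq,
        Finset.mem_univ, if_true, Finset.sum_const, Finset.card_univ, Fintype.card_fin,
        nsmul_eq_mul, mul_one]
      field_simp
      norm_num
    have : ∑ z, r z
        = ∑ s : Fin n → S, ∑ y : Fin n → Y, (∏ j, PS (s j) * q (s j) (y j))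
          * ∑ m, (1 / (M : ℝ)) * τ m s y := by
      simp only [r, Fintype.sum_prod_type]
      rw [Finset.sum_comm]
      refine Finset.sum_congr rfl fun s _ => ?_
      rw [Finset.sum_comm]
      refine Finset.sum_congr rfl fun y _ => ?_
      rw [Finset.mul_sum]
      exact Finset.sum_congr rfl fun m _ => by ring
    rw [this]
    simp only [hτ1, mul_one, Finset.prod_mul_distrib, ← Finset.mul_sum]
    rw [← hPSn]
    refine Finset.sum_congr rfl fun s _ => ?_
    rw [sum_pi_prod (fun j => q (s j))]
    simp [(hq _).2]
  have hfac : ∀ m s y, c.law PS W m s y ≠ 0 → ∀ i,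
      PS (s i) ≠ 0 ∧ W (c.input m s i) (s i) (y i) ≠ 0 := fun m s y h i =>
    mul_ne_zero_iff.1
      (Finset.prod_ne_zero_iff.1 (mul_ne_zero_iff.1 h).2 i (Finset.mem_univ i))
  have hgibbs := sum_mul_log_div_nonneg p r (fun z => hlaw0 _ _ _)
    (fun z => mul_nonneg (mul_nonneg (by positivity)
      (Finset.prod_nonneg fun j _ => mul_nonneg (hPS.1 _) ((hq _).1 _))) (hτ _ _ _).le)
    hp1 hr1.le (fun z hz => by
      refine mul_ne_zero (mul_ne_zero (by positivity)
        (Finset.prod_ne_zero_iff.2 fun j _ => mul_ne_zero (hfac _ _ _ hz j).1 ?_)) (hτ _ _ _).ne'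
      exact hWq _ _ _ hz j)
  have hpt : ∀ z, p z * Real.logb 2 (p z / r z)
      ≤ (∑ i, p z * Real.logb 2 (W (c.input z.1 z.2.1 i) (z.2.1 i) (z.2.2 i)
          / q (z.2.1 i) (z.2.2 i)))
        - (p z - if c.dec z.2.2 z.2.1 = z.1 then 0 else p z) * Real.logb 2 M + p z := by
    rintro ⟨m, s, y⟩
    by_cases hz : p (m, s, y) = 0
    · simp [hz]
    have hf := hfac m s y hz
    have hq0 := hWq m s y hz
    have hratio : p (m, s, y) / r (m, s, y)
        = (∏ i, W (c.input m s i) (s i) (y i) / q (s i) (y i)) / τ m s y := by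
      simp only [p, r, law, Finset.prod_mul_distrib, Finset.prod_div_distrib]
      have h1 : ∏ i, PS (s i) ≠ 0 := Finset.prod_ne_zero_iff.2 fun i _ => (hf i).1
      have h2 : ∏ i, q (s i) (y i) ≠ 0 := Finset.prod_ne_zero_iff.2 fun i _ => hq0 i
      have h3 := (hτ m s y).ne'
      field_simp
    have hlogτ : (if c.dec y s = m then Real.logb 2 M else 0) - 1 ≤ Real.logb 2 (τ m s y) := by
      have h2 : Real.logb 2 2 = 1 := Real.logb_self_eq_one one_lt_two
      simp only [τ]
      split_ifs
      · rw [Real.logb_div (by positivity) two_ne_zero, h2]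
        have := Real.logb_le_logb_of_le one_lt_two hM' (le_add_of_nonneg_right zero_le_one)
        linarith
      · rw [Real.logb_div (by positivity) two_ne_zero, h2]
        simp
    have hdiv : ∀ i, W (c.input m s i) (s i) (y i) / q (s i) (y i) ≠ 0 := fun i =>
      div_ne_zero (hf i).2 (hq0 i)
    rw [hratio, Real.logb_div (Finset.prod_ne_zero_iff.2 fun i _ => hdiv i) (hτ m s y).ne',
      Real.logb_prod _ _ fun i _ => hdiv i, ← Finset.mul_sum]
    have h0 : 0 ≤ p (m, s, y) := hlaw0 _ _ _
    have := mul_le_mul_of_nonneg_left hlogτ h0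
    rw [mul_sub]
    dsimp only
    split_ifs at this ⊢ <;> linarith
  have hsum := hgibbs.trans (Finset.sum_le_sum fun z _ => hpt z)
  rw [Finset.sum_add_distrib, Finset.sum_sub_distrib, ← Finset.sum_mul, Finset.sum_sub_distrib,
    hp1] at hsum
  have herr : (∑ z : Fin M × (Fin n → S) × (Fin n → Y),
      if c.dec z.2.2 z.2.1 = z.1 then 0 else p z) = c.errorProb PS W := by
    simp only [Fintype.sum_prod_type, errorProb, p]
  have hmain : (∑ z : Fin M × (Fin n → S) × (Fin n → Y), ∑ i,
      p z * Real.logb 2 (W (c.input z.1 z.2.1 i) (z.2.1 i) (z.2.2 i) / q (z.2.1 i) (z.2.2 i)))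
      = ∑ i, ∑ m, ∑ s : Fin n → S, (1 / (M : ℝ)) * (∏ j, PS (s j)) *
          ∑ b, W (c.input m s i) (s i) b *
            Real.logb 2 (W (c.input m s i) (s i) b / q (s i) b) := by
    rw [Finset.sum_comm]
    refine Finset.sum_congr rfl fun i _ => ?_
    simp only [Fintype.sum_prod_type, p]
    exact Finset.sum_congr rfl fun m _ => Finset.sum_congr rfl fun s _ =>
      sum_law_mul PS (fun x s => (hW x s).2) c m s i
        fun b => Real.logb 2 (W (c.input m s i) (s i) b / q (s i) b)
  rw [herr, hmain] at hsum
  linarith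

open Classical in
/-- The probability that the `i`-th input is `x` when message `m` is sent and the `i`-th observed
symbol is replaced by `se`, all other states being random. Since the encoder sees the state `s i`
only through `probe (s i) (act m i)`, this is the law of the `i`-th input given the state `s i`
when `se = probe (s i) (act m i)`. -/
noncomputable def inputProb [Fintype S] (PS : S → ℝ) (c : Code S X Y M n) (m : Fin M)
    (i : Fin n) (se : Option S) (x : X) : ℝ :=
  ∑ s : Fin n → S, (∏ j, PS (s j)) *
    if c.enc m (Function.update (c.observed m s) i se) i = x then 1 else 0

theorem inputProb_nonneg [Fintype S] {PS : S → ℝ} (hPS : ∀ s, 0 ≤ PS s) (c : Code S X Y M n)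
    (m : Fin M) (i : Fin n) (se : Option S) (x : X) : 0 ≤ c.inputProb PS m i se x :=
  Finset.sum_nonneg fun s _ => mul_nonneg (Finset.prod_nonneg fun j _ => hPS _)
    (by split_ifs <;> simp)

theorem sum_inputProb_mul [Fintype S] [Fintype X] (PS : S → ℝ) (c : Code S X Y M n)
    (m : Fin M) (i : Fin n) (se : Option S) (g : X → ℝ) :
    ∑ x, c.inputProb PS m i se x * g x
      = ∑ s : Fin n → S, (∏ j, PS (s j)) *
          g (c.enc m (Function.update (c.observed m s) i se) i) := by
  simp only [inputProb, Finset.sum_mul]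
  rw [Finset.sum_comm]
  refine Finset.sum_congr rfl fun s _ => ?_
  rw [Finset.sum_eq_single (c.enc m (Function.update (c.observed m s) i se) i)]
  · simp
  · intro x _ hx
    simp [hx.symm]
  · simp

theorem sum_inputProb [Fintype S] [Fintype X] {PS : S → ℝ} (hPS : ∑ s, PS s = 1)
    (c : Code S X Y M n) (m : Fin M) (i : Fin n) (se : Option S) :
    ∑ x, c.inputProb PS m i se x = 1 := by
  have := c.sum_inputProb_mul PS m i se (fun _ => 1)
  simp only [mul_one] at this
  rw [this, sum_pi_prod (fun _ => PS)]
  simp [hPS]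

theorem observed_update (c : Code S X Y M n) (m : Fin M) (s : Fin n → S) (i : Fin n) (b : S) :
    c.observed m (Function.update s i b)
      = Function.update (c.observed m s) i (probe b (c.act m i)) := by
  funext j
  rcases eq_or_ne j i with rfl | h
  · simp [observed]
  · simp [observed, h]

/-- The joint law of the `i`-th input and state, for message `m`. -/
theorem sum_input_state [Fintype S] [Fintype X] {PS : S → ℝ} (hPS : ∑ s, PS s = 1)
    (c : Code S X Y M n) (m : Fin M) (i : Fin n) (φ : X → S → ℝ) :
    ∑ s : Fin n → S, (∏ j, PS (s j)) * φ (c.input m s i) (s i)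
      = ∑ b, PS b * ∑ x, c.inputProb PS m i (probe b (c.act m i)) x * φ x b := by
  rw [← sum_resample PS hPS i fun s => φ (c.input m s i) (s i)]
  simp only [sum_inputProb_mul PS c m i _ (fun x => φ x _), Finset.mul_sum]
  rw [Finset.sum_comm]
  refine Finset.sum_congr rfl fun b _ => Finset.sum_congr rfl fun s _ => ?_
  simp only [input, observed_update, Function.update_self]
  ring

theorem inputProb_ne_zero [Fintype S] {PS : S → ℝ} (hPS : ∀ s, 0 ≤ PS s)
    (c : Code S X Y M n) (m : Fin M) (i : Fin n) (s : Fin n → S) (hs : ∏ j, PS (s j) ≠ 0) :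
    c.inputProb PS m i (probe (s i) (c.act m i)) (c.input m s i) ≠ 0 := by
  classical
  have h0 : ∀ s : Fin n → S, 0 ≤ ∏ j, PS (s j) := fun s => Finset.prod_nonneg fun j _ => hPS _
  refine (Finset.sum_pos' (fun t _ => mul_nonneg (h0 t) (by split_ifs <;> simp))
    ⟨s, Finset.mem_univ s, ?_⟩).ne'
  rw [← observed_update, Function.update_eq_self,
    if_pos (show c.enc m (c.observed m s) i = c.input m s i from rfl), mul_one]
  exact (h0 s).lt_of_ne' hs

end Code

/-- Disintegration of a joint law of action and input, for each observed symbol `se`. -/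
theorem exists_conditional {S X : Type*} [Fintype X] [Nonempty X] (PA : Bool → ℝ)
    (T : Option S → Bool → X → ℝ) (hT : ∀ se a x, 0 ≤ T se a x)
    (hTA : ∀ se a, ∑ x, T se a x = PA a) :
    ∃ Q : Option S → Bool → X → ℝ, (∀ se a, Q se a ∈ stdSimplex ℝ X) ∧
      ∀ se a x, PA a * Q se a x = T se a x := by
  classical
  obtain ⟨x₀⟩ := ‹Nonempty X›
  -- Where `PA a = 0` the conditional law is arbitrary, and both sides of the identity vanish.
  refine ⟨fun se a => if PA a = 0 then Pi.single x₀ 1 else fun x => T se a x / PA a,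
    fun se a => ?_, fun se a x => ?_⟩
  · dsimp only
    split_ifs with h
    · exact single_mem_stdSimplex ℝ x₀
    · refine ⟨fun x => div_nonneg (hT _ _ _) ?_, ?_⟩
      · rw [← hTA se a]
        exact Finset.sum_nonneg fun x _ => hT _ _ _
      · rw [← Finset.sum_div, hTA, div_self h]
  · dsimp only
    split_ifs with h
    · have := (Finset.sum_eq_zero_iff_of_nonneg fun x _ => hT se a x).1 ((hTA se a).trans h) x
        (Finset.mem_univ x)
      rw [h, zero_mul, this]
    · rw [mul_div_cancel₀ _ h]

/-- Single-letter bound for one code. Averaging the actions and the input laws over the message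
and over time gives a feasible pair, for which the output law `P(y|s)` may be taken as the
reference law in `Code.logb_card_le`. -/
theorem exists_feasible_logb_card_le {S X Y : Type*} [Fintype S] [Fintype X] [Nonempty X]
    [Fintype Y] {PS : S → ℝ} (hPS : PS ∈ stdSimplex ℝ S) {W : X → S → Y → ℝ}
    (hW : ∀ x s, W x s ∈ stdSimplex ℝ Y) {Λ : Bool → ℝ} {Γ : ℝ} {M n : ℕ} (hM : 0 < M)
    (hn : 0 < n) (c : Code S X Y M n) (hc : c.MeetsCost Λ Γ) :
    ∃ p ∈ feasible S X Λ Γ,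
      (1 - c.errorProb PS W) * Real.logb 2 M - 1 ≤ n * info PS W (inputLaw p.1 p.2) := by
  classical
  have hM' : (0 : ℝ) < M := by exact_mod_cast hM
  have hn' : (0 : ℝ) < n := by exact_mod_cast hn
  set κ : ℝ := 1 / ((n : ℝ) * M) with hκ
  have hκ0 : 0 < κ := by positivity
  let PA : Bool → ℝ := fun a => ∑ m, ∑ i, κ * if c.act m i = a then 1 else 0
  let T : Option S → Bool → X → ℝ := fun se a x =>
    ∑ m, ∑ i, κ * (if c.act m i = a then 1 else 0) * c.inputProb PS m i se x
  obtain ⟨Q, hQ, hQT⟩ := exists_conditional PA T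
    (fun se a x => Finset.sum_nonneg fun m _ => Finset.sum_nonneg fun i _ =>
      mul_nonneg (mul_nonneg hκ0.le (by split_ifs <;> simp)) (c.inputProb_nonneg hPS.1 m i se x))
    (fun se a => by
      simp only [T, PA]
      rw [Finset.sum_comm]
      refine Finset.sum_congr rfl fun m _ => ?_
      rw [Finset.sum_comm]
      refine Finset.sum_congr rfl fun i _ => ?_
      rw [← Finset.mul_sum, c.sum_inputProb hPS.2, mul_one])
  have hPA_mul : ∀ f : Bool → ℝ, ∑ a, PA a * f a = ∑ m, ∑ i, κ * f (c.act m i) := fun f => by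
    simp only [PA, Finset.sum_mul]
    rw [Finset.sum_comm]
    refine Finset.sum_congr rfl fun m _ => ?_
    rw [Finset.sum_comm]
    exact Finset.sum_congr rfl fun i _ => by simp
  have hPA : PA ∈ stdSimplex ℝ Bool := by
    refine ⟨fun a => Finset.sum_nonneg fun m _ => Finset.sum_nonneg fun i _ =>
      mul_nonneg hκ0.le (by split_ifs <;> simp), ?_⟩
    have := hPA_mul fun _ => 1
    simp only [mul_one] at this
    rw [this]
    simp only [Finset.sum_const, Finset.card_univ, Fintype.card_fin, nsmul_eq_mul, κ]
    field_simp
  have hcost : ∑ a, PA a * Λ a ≤ Γ := by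
    rw [hPA_mul]
    have h1 : ∀ m, ∑ i, κ * Λ (c.act m i) ≤ (1 / (M : ℝ)) * Γ := fun m => by
      have := mul_le_mul_of_nonneg_left (hc m) (one_div_pos.2 hM').le
      refine le_trans (le_of_eq ?_) this
      rw [← Finset.mul_sum, hκ]
      field_simp
    refine (Finset.sum_le_sum fun m _ => h1 m).trans (le_of_eq ?_)
    simp only [Finset.sum_const, Finset.card_univ, Fintype.card_fin, nsmul_eq_mul]
    field_simp
  have hV : ∀ x s, inputLaw PA Q x s
      = ∑ m, ∑ i, κ * c.inputProb PS m i (probe s (c.act m i)) x := fun x s => by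
    simp only [inputLaw, hQT, T]
    rw [Finset.sum_comm]
    refine Finset.sum_congr rfl fun m _ => ?_
    rw [Finset.sum_comm]
    refine Finset.sum_congr rfl fun i _ => ?_
    simp only [mul_ite, mul_one, mul_zero, ite_mul, zero_mul, Finset.sum_ite_eq,
      Finset.mem_univ, if_true]
  refine ⟨(PA, Q), ⟨hPA, hQ, hcost⟩, ?_⟩
  let q : S → Y → ℝ := fun s y => ∑ x, inputLaw PA Q x s * W x s y
  have hq : ∀ s, q s ∈ stdSimplex ℝ Y := fun s => by
    refine ⟨fun y => Finset.sum_nonneg fun x _ =>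
      mul_nonneg (inputLaw_nonneg hPA hQ x s) ((hW x s).1 y), ?_⟩
    simp only [q]
    rw [Finset.sum_comm]
    simp only [← Finset.mul_sum, (hW _ _).2, mul_one]
    exact sum_inputLaw hPA hQ s
  refine (c.logb_card_le hPS hW hM q hq fun m s y hne i => ?_).trans (le_of_eq ?_)
  · have hprod := (mul_ne_zero_iff.1 hne).2
    rw [Finset.prod_mul_distrib] at hprod
    have hWi := Finset.prod_ne_zero_iff.1 (mul_ne_zero_iff.1 hprod).2 i (Finset.mem_univ i)
    have hVi : 0 < inputLaw PA Q (c.input m s i) (s i) := by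
      rw [hV]
      have h0 : ∀ m i, 0 ≤ κ * c.inputProb PS m i (probe (s i) (c.act m i)) (c.input m s i) :=
        fun m i => mul_nonneg hκ0.le (c.inputProb_nonneg hPS.1 _ _ _ _)
      refine Finset.sum_pos' (fun m' _ => Finset.sum_nonneg fun i' _ =>
        mul_nonneg hκ0.le (c.inputProb_nonneg hPS.1 _ _ _ _)) ⟨m, Finset.mem_univ m, ?_⟩
      refine Finset.sum_pos' (fun i' _ =>
        mul_nonneg hκ0.le (c.inputProb_nonneg hPS.1 _ _ _ _)) ⟨i, Finset.mem_univ i, ?_⟩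
      exact mul_pos hκ0 ((c.inputProb_nonneg hPS.1 _ _ _ _).lt_of_ne'
        (c.inputProb_ne_zero hPS.1 m i s (mul_ne_zero_iff.1 hprod).1))
    exact (Finset.sum_pos' (fun x _ => mul_nonneg (inputLaw_nonneg hPA hQ x _) ((hW x _).1 _))
      ⟨_, Finset.mem_univ _, mul_pos hVi (((hW _ _).1 _).lt_of_ne' hWi)⟩).ne'
  · let φ : X → S → ℝ := fun x s => ∑ b, W x s b * Real.logb 2 (W x s b / q s b)
    have hL : ∀ i m, ∑ s : Fin n → S, (1 / (M : ℝ)) * (∏ j, PS (s j)) * φ (c.input m s i) (s i)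
        = (n : ℝ) * ∑ b, PS b * ∑ x, κ * c.inputProb PS m i (probe b (c.act m i)) x * φ x b := by
      intro i m
      simp only [mul_assoc, ← Finset.mul_sum]
      rw [c.sum_input_state hPS.2]
      simp only [mul_left_comm _ κ, ← Finset.mul_sum]
      rw [← mul_assoc, hκ]
      congr 1
      field_simp
    have hR : info PS W (inputLaw PA Q) = ∑ s, PS s * ∑ x, inputLaw PA Q x s * φ x s := rfl
    change ∑ i, ∑ m, ∑ s : Fin n → S,
      (1 / (M : ℝ)) * (∏ j, PS (s j)) * φ (c.input m s i) (s i) = _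
    simp only [hL, hR, ← Finset.mul_sum, hV]
    congr 1
    rw [Finset.sum_comm]
    simp only [Finset.mul_sum, Finset.sum_mul]
    rw [Finset.sum_congr rfl fun m _ => Finset.sum_comm, Finset.sum_comm]
    refine Finset.sum_congr rfl fun s _ => ?_
    rw [Finset.sum_congr rfl fun m _ => Finset.sum_comm, Finset.sum_comm]

/-- Rates achievable with non-causal encoding do not exceed any upper bound on the information
over the feasible pairs. -/
theorem AchievableNoncausal.le_of_info_le {S X Y : Type*} [Fintype S] [Fintype X] [Nonempty X]
    [Fintype Y] {PS : S → ℝ} (hPS : PS ∈ stdSimplex ℝ S) {W : X → S → Y → ℝ}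
    (hW : ∀ x s, W x s ∈ stdSimplex ℝ Y) {Λ : Bool → ℝ} {Γ C R : ℝ}
    (hC : ∀ p ∈ feasible S X Λ Γ, info PS W (inputLaw p.1 p.2) ≤ C)
    (hR : AchievableNoncausal PS W Λ Γ R) : R ≤ C := by
  obtain ⟨M, c, hc, hlim⟩ := hR
  have h1 : Tendsto (fun n : ℕ => (1 - (c n).errorProb PS W) * R - 1 / (n : ℝ)) atTop
      (𝓝 ((1 - 0) * R - 0)) :=
    ((tendsto_const_nhds.sub hlim).mul_const R).sub tendsto_one_div_atTop_nhds_zero_nat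
  rw [sub_zero, sub_zero, one_mul] at h1
  refine le_of_tendsto h1 ?_
  filter_upwards [eventually_ge_atTop 1, hlim.eventually (gt_mem_nhds one_pos)] with n hn hlt
  obtain ⟨hM, hrate, hcost⟩ := hc n hn
  obtain ⟨p, hp, hle⟩ := exists_feasible_logb_card_le hPS hW hM hn (c n) hcost
  have hn' : (0 : ℝ) < n := by exact_mod_cast hn
  have h2 := mul_le_mul_of_nonneg_left hrate (sub_pos.2 hlt).le
  have h3 : ((1 - (c n).errorProb PS W) * Real.logb 2 (M n) - 1) / n ≤ C :=
    (div_le_iff₀' hn').2 (hle.trans (mul_le_mul_of_nonneg_left (hC p hp) hn'.le))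
  refine le_trans ?_ h3
  rw [sub_div, mul_div_assoc]
  linarith

/-! ### Achievability with causal codes -/

/-- Mixing `P_A` with a cheap action makes the cost constraint strict at an arbitrarily small loss
of information; if no action costs less than `Γ`, then `P_A` uses only actions of cost `Γ`. -/
theorem exists_feasible_slack {S X Y : Type*} [Fintype S] [Fintype X] [Fintype Y] (PS : S → ℝ)
    {W : X → S → Y → ℝ} (hW : ∀ x s, W x s ∈ stdSimplex ℝ Y) {Λ : Bool → ℝ} {Γ R : ℝ}
    {p : (Bool → ℝ) × (Option S → Bool → X → ℝ)} (hp : p ∈ feasible S X Λ Γ)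
    (hR : R < info PS W (inputLaw p.1 p.2)) :
    ∃ p' ∈ feasible S X Λ Γ, R < info PS W (inputLaw p'.1 p'.2) ∧
      (0 < ∑ a, p'.1 a * (Γ - Λ a) ∨ ∀ a, p'.1 a ≠ 0 → 0 ≤ Γ - Λ a) := by
  classical
  obtain ⟨PA, Q⟩ := p
  obtain ⟨hPA, hQ, hcost⟩ := hp
  dsimp only at hPA hQ hcost hR
  have hslack : ∀ P ∈ stdSimplex ℝ Bool, ∑ a, P a * (Γ - Λ a) = Γ - ∑ a, P a * Λ a := by
    intro P hP
    simp only [mul_sub, Finset.sum_sub_distrib, ← Finset.sum_mul, hP.2, one_mul]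
  by_cases hlt : ∃ a, Λ a < Γ
  · obtain ⟨a₀, ha₀⟩ := hlt
    let P : ℝ → Bool → ℝ := fun t => (1 - t) • PA + t • Pi.single a₀ 1
    have hP : ∀ t ∈ Set.Icc (0 : ℝ) 1, P t ∈ stdSimplex ℝ Bool := fun t ht =>
      convex_stdSimplex ℝ Bool hPA (single_mem_stdSimplex ℝ a₀) (sub_nonneg.2 ht.2) ht.1 (by ring)
    have hcont : ContinuousOn (fun t => info PS W (inputLaw (P t) Q)) (Set.Icc 0 1) := by
      refine (continuousOn_info PS hW).comp (t := {V | ∀ x s, 0 ≤ V x s})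
        (f := fun t => inputLaw (P t) Q) ?_ fun t ht => inputLaw_nonneg (hP t ht) hQ
      have : Continuous fun t => (P t, Q) := by fun_prop
      exact (continuous_inputLaw.comp this).continuousOn
    have h0 : Tendsto (fun t => info PS W (inputLaw (P t) Q)) (𝓝[>] 0)
        (𝓝 (info PS W (inputLaw PA Q))) := by
      have h := (hcont 0 (by simp)).mono Set.Ioc_subset_Icc_self
      rw [ContinuousWithinAt, nhdsWithin_Ioc_eq_nhdsGT one_pos] at h
      simpa [P] using h
    obtain ⟨t, hRt, ht⟩ := ((h0.eventually (lt_mem_nhds hR)).and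
      (Ioc_mem_nhdsGT (one_pos (α := ℝ)))).exists
    have htI : t ∈ Set.Icc (0 : ℝ) 1 := ⟨ht.1.le, ht.2⟩
    have hct : ∑ a, P t a * Λ a < Γ := by
      have : ∑ a, P t a * Λ a = (1 - t) * ∑ a, PA a * Λ a + t * Λ a₀ := by
        simp [P, add_mul, Finset.sum_add_distrib, mul_assoc, Pi.single_apply]
        ring
      rw [this]
      have h1 := mul_le_mul_of_nonneg_left hcost (sub_nonneg.2 ht.2)
      have h2 := mul_lt_mul_of_pos_left ha₀ ht.1
      linarith
    refine ⟨(P t, Q), ⟨hP t htI, hQ, hct.le⟩, hRt, Or.inl ?_⟩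
    rw [hslack _ (hP t htI)]
    exact sub_pos.2 hct
  · push Not at hlt
    refine ⟨(PA, Q), ⟨hPA, hQ, hcost⟩, hR, Or.inr fun a ha => ?_⟩
    have hle : ∀ a ∈ Finset.univ, PA a * (Γ - Λ a) ≤ 0 := fun a _ =>
      mul_nonpos_of_nonneg_of_nonpos (hPA.1 a) (sub_nonpos.2 (hlt a))
    have hzero : ∑ a, PA a * (Γ - Λ a) = 0 :=
      le_antisymm (Finset.sum_nonpos hle) (by rw [hslack _ hPA]; exact sub_nonneg.2 hcost)
    have := (Finset.sum_eq_zero_iff_of_nonpos hle).1 hzero a (Finset.mem_univ a)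
    exact ((mul_eq_zero.1 this).resolve_left ha).ge

/-- A Shannon strategy: an action together with a map from observed symbols to inputs. Strategies
are the input letters of a memoryless channel with output `(s, y)`. -/
abbrev Strategy (S X : Type*) : Type _ := Bool × (Option S → X)

open Classical in
/-- The law on strategies that draws an action from `P_A` and, independently for each observed
symbol, an input from `P_{X|S_e,A}`. -/
noncomputable def strategyLaw {S X : Type*} [Fintype S] (PA : Bool → ℝ)
    (Q : Option S → Bool → X → ℝ) (u : Strategy S X) : ℝ :=
  PA u.1 * ∏ se, Q se u.1 (u.2 se)

/-- The channel from strategies to pairs of state and output. -/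
def strategyChannel {S X Y : Type*} (PS : S → ℝ) (W : X → S → Y → ℝ) (u : Strategy S X)
    (z : S × Y) : ℝ :=
  PS z.1 * W (u.2 (probe z.1 u.1)) z.1 z.2

theorem strategyLaw_nonneg {S X : Type*} [Fintype S] [Fintype X] {PA : Bool → ℝ}
    {Q : Option S → Bool → X → ℝ} (hPA : PA ∈ stdSimplex ℝ Bool)
    (hQ : ∀ se a, Q se a ∈ stdSimplex ℝ X) (u : Strategy S X) : 0 ≤ strategyLaw PA Q u :=
  mul_nonneg (hPA.1 _) (Finset.prod_nonneg fun _ _ => (hQ _ _).1 _)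

open Classical in
theorem sum_strategyLaw_mul_action {S X : Type*} [Fintype S] [Fintype X] (PA : Bool → ℝ)
    {Q : Option S → Bool → X → ℝ} (hQ : ∀ se a, Q se a ∈ stdSimplex ℝ X) (g : Bool → ℝ) :
    ∑ u, strategyLaw PA Q u * g u.1 = ∑ a, PA a * g a := by
  rw [Fintype.sum_prod_type]
  refine Finset.sum_congr rfl fun a _ => ?_
  simp only [strategyLaw]
  rw [← Finset.sum_mul, ← Finset.mul_sum, sum_pi_prod (fun se => Q se a)]
  simp [(hQ _ _).2]

open Classical in
/-- Under `strategyLaw`, the input that results from state `s` has law `inputLaw PA Q · s`. -/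
theorem sum_strategyLaw_mul_input {S X : Type*} [Fintype S] [Fintype X] (PA : Bool → ℝ)
    {Q : Option S → Bool → X → ℝ} (hQ : ∀ se a, Q se a ∈ stdSimplex ℝ X) (s : S) (g : X → ℝ) :
    ∑ u : Strategy S X, strategyLaw PA Q u * g (u.2 (probe s u.1))
      = ∑ x, inputLaw PA Q x s * g x := by
  rw [Fintype.sum_prod_type]
  simp only [strategyLaw, inputLaw, Finset.sum_mul]
  rw [Finset.sum_comm (s := (Finset.univ : Finset X))]
  refine Finset.sum_congr rfl fun a _ => ?_
  simp only [mul_assoc, ← Finset.mul_sum]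
  rw [sum_pi_prod_mul (fun se => Q se a) (fun se => (hQ se a).2)]

open Classical in
/-- The mutual information of the strategy channel equals `I(X;Y|S)`. -/
theorem mutualInfo_strategyChannel {S X Y : Type*} [Fintype S] [Fintype X] [Fintype Y]
    (PS : S → ℝ) (W : X → S → Y → ℝ) (PA : Bool → ℝ)
    {Q : Option S → Bool → X → ℝ} (hQ : ∀ se a, Q se a ∈ stdSimplex ℝ X) :
    ∑ u, ∑ z, strategyLaw PA Q u * strategyChannel PS W u z *
        Real.logb 2 (strategyChannel PS W u z /
          ∑ u', strategyLaw PA Q u' * strategyChannel PS W u' z)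
      = info PS W (inputLaw PA Q) := by
  have hout : ∀ z : S × Y, ∑ u', strategyLaw PA Q u' * strategyChannel PS W u' z
      = PS z.1 * ∑ x, inputLaw PA Q x z.1 * W x z.1 z.2 := fun z => by
    rw [← sum_strategyLaw_mul_input PA hQ z.1 (fun x => W x z.1 z.2), Finset.mul_sum]
    exact Finset.sum_congr rfl fun u _ => by rw [strategyChannel]; ring
  rw [Finset.sum_comm, Fintype.sum_prod_type, info]
  refine Finset.sum_congr rfl fun s _ => ?_
  simp only [Finset.mul_sum]
  rw [Finset.sum_comm (s := (Finset.univ : Finset X))]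
  refine Finset.sum_congr rfl fun y _ => ?_
  rw [← Finset.mul_sum, ← sum_strategyLaw_mul_input PA hQ s (fun x => W x s y *
    Real.logb 2 (W x s y / ∑ x', inputLaw PA Q x' s * W x' s y)), Finset.mul_sum]
  refine Finset.sum_congr rfl fun u _ => ?_
  simp only [hout]
  rw [strategyChannel]
  by_cases hs : PS s = 0
  · simp [hs]
  rw [mul_div_mul_left _ _ hs]
  ring

/-- The causal code that applies, letter by letter, a code for the strategy channel. -/
def Code.ofStrategies {S X Y : Type*} {M n : ℕ} (u : Fin M → Fin n → Strategy S X)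
    (d : (Fin n → S × Y) → Fin M) : Code S X Y M n where
  act m i := (u m i).1
  enc m t i := (u m i).2 (t i)
  dec y s := d fun i => (s i, y i)

theorem Code.isCausal_ofStrategies {S X Y : Type*} {M n : ℕ} (u : Fin M → Fin n → Strategy S X)
    (d : (Fin n → S × Y) → Fin M) : (Code.ofStrategies u d).IsCausal :=
  fun m i _ _ h => congrArg (u m i).2 (h i le_rfl)

theorem Code.errorProb_ofStrategies {S X Y : Type*} [Fintype S] [Fintype Y] {M n : ℕ}
    (PS : S → ℝ) (W : X → S → Y → ℝ) (u : Fin M → Fin n → Strategy S X)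
    (d : (Fin n → S × Y) → Fin M) :
    (Code.ofStrategies u d).errorProb PS W = ∑ m, (1 / (M : ℝ)) *
      ∑ z, if d z = m then 0 else ∏ i, strategyChannel PS W (u m i) (z i) := by
  refine Finset.sum_congr rfl fun m _ => ?_
  rw [← (Equiv.arrowProdEquivProdArrow (Fin n) (fun _ => S) (fun _ => Y)).symm.sum_comp,
    Fintype.sum_prod_type, Finset.mul_sum]
  refine Finset.sum_congr rfl fun s _ => ?_
  rw [Finset.mul_sum]
  refine Finset.sum_congr rfl fun y _ => ?_
  rw [mul_ite, mul_zero]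
  rfl

theorem achievableCausal_of_lt_info {S X Y : Type*} [Fintype S] [Fintype X] [Fintype Y]
    {PS : S → ℝ} (hPS : PS ∈ stdSimplex ℝ S) {W : X → S → Y → ℝ}
    (hW : ∀ x s, W x s ∈ stdSimplex ℝ Y) {Λ : Bool → ℝ} {Γ R : ℝ} (hΓ : ∃ a, Λ a ≤ Γ)
    (hR0 : 0 < R) {p : (Bool → ℝ) × (Option S → Bool → X → ℝ)} (hp : p ∈ feasible S X Λ Γ)
    (hR : R < info PS W (inputLaw p.1 p.2)) : AchievableCausal PS W Λ Γ R := by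
  classical
  obtain ⟨⟨PA, Q⟩, ⟨hPA, hQ, -⟩, hRp, hslack⟩ := exists_feasible_slack PS hW hp hR
  dsimp only at hPA hQ hRp hslack
  have hX : Nonempty X := by
    by_contra hX
    rw [not_nonempty_iff] at hX
    simpa using (hQ none true).2
  obtain ⟨M, ε, hε, hM⟩ := exists_channel_codes (strategyLaw PA Q)
    (strategyLaw_nonneg hPA hQ)
    (by
      have h := sum_strategyLaw_mul_action PA hQ fun _ => 1
      simp only [mul_one] at h
      exact h.trans hPA.2)
    (strategyChannel PS W) (fun u z => mul_nonneg (hPS.1 _) ((hW _ _).1 _))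
    (fun u => by
      simp only [Fintype.sum_prod_type, strategyChannel, ← Finset.mul_sum, (hW _ _).2, mul_one,
        hPS.2])
    (fun u => Γ - Λ u.1)
    (hslack.imp (fun h => by rwa [sum_strategyLaw_mul_action PA hQ (fun a => Γ - Λ a)])
      (fun h u hu => h _ (mul_ne_zero_iff.1 hu).1))
    (by
      obtain ⟨a, ha⟩ := hΓ
      exact ⟨(a, fun _ => hX.some), sub_nonneg.2 ha⟩)
    hR0 (by rwa [mutualInfo_strategyChannel PS W PA hQ])
  choose hMle u d hcost herr using hM
  have hMpos : ∀ n, (0 : ℝ) < M n := fun n => (Real.rpow_pos_of_pos two_pos _).trans_le (hMle n)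
  refine ⟨M, fun n => Code.ofStrategies (u n) (d n), fun n hn => ⟨?_, ?_, fun m => ?_,
    Code.isCausal_ofStrategies _ _⟩, ?_⟩
  · exact_mod_cast hMpos n
  · have hn' : (0 : ℝ) < n := by exact_mod_cast hn
    rw [le_div_iff₀' hn']
    exact (Real.le_logb_iff_rpow_le one_lt_two (hMpos n)).2 (hMle n)
  · have hn' : (0 : ℝ) < n := by exact_mod_cast hn
    have h := hcost n m
    rw [Finset.sum_sub_distrib] at h
    simp only [Finset.sum_const, Finset.card_univ, Fintype.card_fin, nsmul_eq_mul] at h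
    rw [one_div, inv_mul_le_iff₀ hn']
    exact sub_nonneg.1 h
  · refine squeeze_zero (fun n => ?_) (fun n => ?_) hε
    · refine Finset.sum_nonneg fun m _ => Finset.sum_nonneg fun s _ =>
        Finset.sum_nonneg fun y _ => ?_
      split_ifs
      exacts [le_rfl, Code.law_nonneg hPS.1 (fun x s => (hW x s).1) _ _ _ _]
    · rw [Code.errorProb_ofStrategies, ← Finset.mul_sum, one_div, inv_mul_le_iff₀ (hMpos n)]
      refine (Finset.sum_le_sum fun m _ => herr n m).trans (le_of_eq ?_)
      simp

/-- Codes with a single message. -/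
theorem achievableCausal_of_nonpos {S X Y : Type*} [Fintype S] [Nonempty X] [Fintype Y]
    (PS : S → ℝ) (W : X → S → Y → ℝ) {Λ : Bool → ℝ} {Γ R : ℝ} (hΓ : ∃ a, Λ a ≤ Γ)
    (hR : R ≤ 0) : AchievableCausal PS W Λ Γ R := by
  obtain ⟨a, ha⟩ := hΓ
  obtain ⟨x⟩ := ‹Nonempty X›
  refine ⟨fun _ => 1, fun n => ⟨fun _ _ => a, fun _ _ _ => x, fun _ _ => 0⟩,
    fun n hn => ⟨one_pos, by simpa using hR, fun m => ?_, fun _ _ _ _ _ => rfl⟩, ?_⟩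
  · have hn' : (n : ℝ) ≠ 0 := by exact_mod_cast (Nat.one_le_iff_ne_zero.1 hn)
    simpa [hn'] using ha
  · refine tendsto_const_nhds.congr fun n => (Eq.symm ?_)
    simp [Code.errorProb]

theorem AchievableCausal.achievableNoncausal {S X Y : Type*} [Fintype S] [Fintype Y]
    {PS : S → ℝ} {W : X → S → Y → ℝ} {Λ : Bool → ℝ} {Γ R : ℝ}
    (h : AchievableCausal PS W Λ Γ R) : AchievableNoncausal PS W Λ Γ R := by
  obtain ⟨M, c, hc, hlim⟩ := h
  exact ⟨M, c, fun n hn => ⟨(hc n hn).1, (hc n hn).2.1, (hc n hn).2.2.1⟩, hlim⟩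

end Probing

theorem theorem1 {S X Y : Type*} [Fintype S] [Fintype X] [Nonempty X] [Fintype Y]
    (PS : S → ℝ) (hPS : PS ∈ stdSimplex ℝ S)
    (W : X → S → Y → ℝ) (hW : ∀ x s, W x s ∈ stdSimplex ℝ Y)
    (Λ : Bool → ℝ) (Γ : ℝ) (hΓ : ∃ a, Λ a ≤ Γ) :
    ∃ C : ℝ,
      IsGreatest (Probing.informationValues PS W Λ Γ) C ∧
      IsLUB {R : ℝ | Probing.AchievableNoncausal PS W Λ Γ R} C ∧
      IsLUB {R : ℝ | Probing.AchievableCausal PS W Λ Γ R} C := by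
  obtain ⟨C, hC⟩ := Probing.exists_isGreatest_informationValues PS hW hΓ
  refine ⟨C, hC, ?_⟩
  rw [Probing.informationValues_eq_image PS hW] at hC
  obtain ⟨⟨p, hp, hpC⟩, hmax⟩ := hC
  have hconv : ∀ R, Probing.AchievableNoncausal PS W Λ Γ R → R ≤ C := fun R hR =>
    hR.le_of_info_le hPS hW fun p hp => hmax ⟨p, hp, rfl⟩
  have hach : ∀ R < C, Probing.AchievableCausal PS W Λ Γ R := fun R hR => by
    rcases le_or_gt R 0 with h0 | h0
    · exact Probing.achievableCausal_of_nonpos PS W hΓ h0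
    · exact Probing.achievableCausal_of_lt_info hPS hW hΓ h0 hp (hR.trans_eq hpC.symm)
  refine ⟨⟨hconv, fun B hB => ?_⟩, ⟨fun R hR => hconv R hR.achievableNoncausal, fun B hB => ?_⟩⟩
  · exact le_of_forall_lt_imp_le_of_dense fun R hR => hB (hach R hR).achievableNoncausal
  · exact le_of_forall_lt_imp_le_of_dense fun R hR => hB (hach R hR)
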